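/- Let $S_n$ denote the set of permutations $\pi=\pi_1\cdots\pi_n$ of $\{1,\ldots,n\}$ in one-line notation. The stack-sorting map $s$ is defined on a permutation $\pi$ as follows, starting with an empty stack and an empty output. At any point, if there is a next entry of the input and either the stack is empty or that entry is smaller than the entry at the top of the stack, then the next input entry is placed on top of the stack; otherwise, the entry at the top of the stack is removed and annexed to the end of the output. The procedure stops when all entries are in the output, and $s(\pi)$ is this output. For $t\geq 1$, a permutation $\pi$ is called $t$-stack-sortable if $s^t(\pi)$ is increasing, where $s^t$ is the $t$-fold iterate of $s$. Let $W_t(n)$ be the number of $t$-stack-sortable permutations in $S_n$. Theorem. For every integer $t\geq 1$, the limit $\lim_{n\to\infty}W_t(n)^{1/n}$ exists and is finite, and \[\lim_{n\to\infty}W_t(n)^{1/n}\geq(\sqrt t+1)^2.\] -/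

import Mathlib

/-- The stack-sorting procedure, run from a state with the given stack (its top is the head of the
first list) and the given remaining input. The value is the list of all entries that are annexed to
the output from this state on. If there is a next input entry `x` and the stack is empty or `x` is
smaller than the top of the stack, then `x` is pushed; otherwise the top of the stack is moved to
the output. -/
def stackRun : List ℕ → List ℕ → List ℕ
  | [], [] => []
  | y :: stack, [] => y :: stackRun stack []
  | [], x :: input => stackRun [x] input
  | y :: stack, x :: input =>
      if x < y then stackRun (x :: y :: stack) input
      else y :: stackRun stack (x :: input)
termination_by stack input => stack.length + 2 * input.length

/-- The stack-sorting map `s`, on permutations in one-line notation: start with an empty stack. -/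
def stackSort (π : List ℕ) : List ℕ := stackRun [] π

/-- A permutation `π` is `t`-stack-sortable if `s^t(π)` is increasing. -/
def IsStackSortable (t : ℕ) (π : List ℕ) : Prop :=
  (stackSort^[t] π).Pairwise (· < ·)

instance (t : ℕ) : DecidablePred (IsStackSortable t) := fun π =>
  inferInstanceAs (Decidable ((stackSort^[t] π).Pairwise (· < ·)))

/-- `S_n`: the orderings of `{1, …, n}`, in one-line notation. -/
def permsOf (n : ℕ) : Finset (List ℕ) := (List.range' 1 n).permutations.toFinset

/-- Membership in `S_n`: the list has no repeated entry, and its entries are exactly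
`1, …, n`. -/
theorem mem_permsOf {n : ℕ} {π : List ℕ} :
    π ∈ permsOf n ↔ π.Nodup ∧ ∀ k, k ∈ π ↔ 1 ≤ k ∧ k ≤ n := by
  have hr : ∀ k, k ∈ List.range' 1 n ↔ 1 ≤ k ∧ k ≤ n := by
    intro k
    rw [List.mem_range'_1]
    omega
  have hn : (List.range' 1 n).Nodup := List.nodup_range'
  rw [permsOf, List.mem_toFinset, List.mem_permutations]
  constructor
  · intro h
    exact ⟨h.nodup_iff.mpr hn, fun k => by rw [h.mem_iff, hr]⟩
  · rintro ⟨h1, h2⟩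
    exact (List.perm_ext_iff_of_nodup h1 hn).mpr fun k => by rw [h2, hr]

/-- `W_t(n)`: the number of `t`-stack-sortable permutations in `S_n`. -/
def stackSortableCount (t n : ℕ) : ℕ := ((permsOf n).filter (IsStackSortable t)).card

/-! The limit exists by Fekete's lemma. Direct sums make the counts supermultiplicative
(`stackSortableCount_mul_le`). A permutation is recovered from its image under `stackSort` and its
word of `2n` pushes and pops, so the counts grow at most exponentially (`stackSortableCount_le`).

The lower bound counts a subclass. One pass of `stackSort` turns `FewBetween (t + 1)` into
`FewBetween t` (`FewBetween.stackSort`), and `FewBetween 0` forbids inversions, so `FewBetween t`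
implies `t`-stack-sortability. Appending last entries produces a tree of such permutations in which
a node labelled `m` has one child of each label `1, …, m` and `t` children labelled `m + 1`. A
bounded weight `f` with `lam * f m ≤ f 1 + ⋯ + f m + t * f (m + 1)` forces growth at least `lam`.
Such a weight comes from a three-term recurrence with negative discriminant, which holds exactly for
`(√t - 1)² < lam < (√t + 1)²`: its solution must reach a nonpositive value and is cut off just
before it. -/

/-! ### Structure of the stack-sorting map -/

theorem stackRun_perm (st inp : List ℕ) : (stackRun st inp).Perm (st ++ inp) := by
  fun_induction stackRun st inp with
  | case1 => simp
  | case2 y st ih => simpa using ih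
  | case3 x inp ih => simpa using ih
  | case4 y st x inp h ih =>
    refine ih.trans ?_
    exact (List.perm_middle (l₁ := y :: st)).symm
  | case5 y st x inp h ih => simpa using ih

theorem stackSort_perm (π : List ℕ) : (stackSort π).Perm π := stackRun_perm [] π

theorem stackSort_iterate_perm (t : ℕ) (π : List ℕ) : (stackSort^[t] π).Perm π := by
  induction t generalizing π with
  | zero => exact List.Perm.refl _
  | succ t ih => exact (ih _).trans (stackSort_perm π)

/-- An entry larger than everything before it empties the stack. -/
theorem stackRun_append_cons (st l r : List ℕ) (x : ℕ) (hst : ∀ y ∈ st, y ≤ x)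
    (hl : ∀ y ∈ l, y ≤ x) :
    stackRun st (l ++ x :: r) = stackRun st l ++ stackRun [x] r := by
  fun_induction stackRun st l with
  | case1 => simp [stackRun]
  | case2 y st ih =>
    have hy := hst y (by simp)
    simp only [List.nil_append, List.cons_append] at ih ⊢
    rw [stackRun, if_neg (by omega), ih (fun z hz => hst z (by simp [hz])) (by simp)]
  | case3 z inp ih =>
    rw [List.cons_append, stackRun]
    exact ih (by simpa using hl z (by simp)) (fun y hy => hl y (by simp [hy]))
  | case4 y st z inp h ih =>
    rw [List.cons_append, stackRun, if_pos h]
    refine ih ?_ (fun y hy => hl y (by simp [hy]))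
    intro w hw
    rcases List.mem_cons.mp hw with rfl | hw
    · exact hl w (by simp)
    · exact hst w hw
  | case5 y st z inp h ih =>
    rw [List.cons_append, stackRun, if_neg h, ← List.cons_append,
      ih (fun w hw => hst w (by simp [hw])) hl, List.cons_append]

/-- An entry at the bottom of the stack, larger than everything else, leaves last. -/
theorem stackRun_append_singleton (st r : List ℕ) (x : ℕ) (hr : ∀ y ∈ r, y < x) :
    stackRun (st ++ [x]) r = stackRun st r ++ [x] := by
  fun_induction stackRun st r with
  | case1 => simp [stackRun]
  | case2 y st ih => rw [List.cons_append, stackRun, ih (by simp), List.cons_append]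
  | case3 z inp ih =>
    rw [List.nil_append, stackRun, if_pos (hr z (by simp))]
    exact ih (fun y hy => hr y (by simp [hy]))
  | case4 y st z inp h ih =>
    rw [List.cons_append, stackRun, if_pos h]
    exact ih (fun y hy => hr y (by simp [hy]))
  | case5 y st z inp h ih =>
    rw [List.cons_append, stackRun, if_neg h, ih hr, List.cons_append]

/-- The maximum `x` first flushes the stack, then lies at its bottom until the end. -/
theorem stackSort_append_cons (l r : List ℕ) (x : ℕ) (hl : ∀ y ∈ l, y ≤ x)
    (hr : ∀ y ∈ r, y < x) :
    stackSort (l ++ x :: r) = stackSort l ++ stackSort r ++ [x] := by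
  rw [stackSort, stackRun_append_cons [] l r x (by simp) hl,
    ← List.nil_append [x], stackRun_append_singleton [] r x hr]
  simp [stackSort]

theorem stackSort_append (l r : List ℕ) (h : ∀ y ∈ l, ∀ x ∈ r, y ≤ x) :
    stackSort (l ++ r) = stackSort l ++ stackSort r := by
  cases r with
  | nil => simp [stackSort, stackRun]
  | cons x r =>
    rw [stackSort, stackRun_append_cons [] l r x (by simp) (fun y hy => h y hy x (by simp)),
      stackSort, stackSort]
    conv_rhs => rw [stackRun.eq_3]

theorem stackSort_iterate_append (t : ℕ) (l r : List ℕ) (h : ∀ y ∈ l, ∀ x ∈ r, y ≤ x) :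
    stackSort^[t] (l ++ r) = stackSort^[t] l ++ stackSort^[t] r := by
  induction t generalizing l r with
  | zero => rfl
  | succ t ih =>
    simp only [Function.iterate_succ_apply]
    rw [stackSort_append l r h]
    exact ih _ _ fun y hy x hx =>
      h y ((stackSort_perm l).mem_iff.mp hy) x ((stackSort_perm r).mem_iff.mp hx)

theorem stackRun_map {f : ℕ → ℕ} (hf : StrictMono f) (st inp : List ℕ) :
    stackRun (st.map f) (inp.map f) = (stackRun st inp).map f := by
  fun_induction stackRun st inp with
  | case1 => simp [stackRun]
  | case2 y st ih => simpa [stackRun] using ih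
  | case3 x inp ih => simpa [stackRun] using ih
  | case4 y st x inp h ih => simpa [stackRun, hf.lt_iff_lt, h] using ih
  | case5 y st x inp h ih => simpa [stackRun, hf.lt_iff_lt, h] using ih

theorem stackSort_iterate_map {f : ℕ → ℕ} (hf : StrictMono f) (t : ℕ) (π : List ℕ) :
    stackSort^[t] (π.map f) = (stackSort^[t] π).map f := by
  induction t generalizing π with
  | zero => rfl
  | succ t ih =>
    simp only [Function.iterate_succ_apply]
    rw [← ih, stackSort, stackSort, ← stackRun_map hf, List.map_nil]

/-! ### A sufficient condition for sortability -/

theorem append_eq_append_cons_cases {α : Type*} {l r l₁ l₂ : List α} {c : α}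
    (h : l ++ r = l₁ ++ c :: l₂) :
    (∃ u, l₁ = l ++ u ∧ r = u ++ c :: l₂) ∨ ∃ u, l = l₁ ++ c :: u ∧ l₂ = u ++ r := by
  rcases List.append_eq_append_iff.mp h with h | ⟨u, rfl, hu⟩
  · exact Or.inl h
  · rcases u with _ | ⟨w, u⟩
    · exact Or.inl ⟨[], by simp, by simpa using hu.symm⟩
    · simp only [List.cons_append, List.cons.injEq] at hu
      obtain ⟨rfl, rfl⟩ := hu
      exact Or.inr ⟨u, rfl, rfl⟩

theorem exists_eq_append_cons_max {π : List ℕ} (hπ : π.Nodup) (hne : π ≠ []) :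
    ∃ l x r, π = l ++ x :: r ∧ (∀ y ∈ l, y < x) ∧ ∀ y ∈ r, y < x := by
  obtain ⟨x, hx⟩ : ∃ x, x ∈ π.argmax id :=
    Option.ne_none_iff_exists'.mp (by simpa [List.argmax_eq_none] using hne)
  obtain ⟨l, r, rfl⟩ := List.append_of_mem (List.argmax_mem hx)
  have hle : ∀ y ∈ l ++ x :: r, y ≤ x := fun y hy => List.le_of_mem_argmax hy hx
  have hx' : x ∉ l ∧ x ∉ r := by
    have := (List.nodup_middle.mp hπ)
    simpa using (List.nodup_cons.mp this).1
  refine ⟨l, x, r, rfl, fun y hy => ?_, fun y hy => ?_⟩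
  · exact lt_of_le_of_ne (hle y (by simp [hy])) (by rintro rfl; exact hx'.1 hy)
  · exact lt_of_le_of_ne (hle y (by simp [hy])) (by rintro rfl; exact hx'.2 hy)

/-- An inversion `c, a` of `stackSort π` comes from an entry `d > c` of `π` between `c` and `a`,
and `d` can be chosen after all entries that leave the stack before `c` and are smaller. -/
theorem exists_between_of_stackSort_inversion {π : List ℕ} (hπ : π.Nodup) {l₁ l₂ : List ℕ}
    {a c : ℕ} (hs : stackSort π = l₁ ++ c :: l₂) (ha : a ∈ l₂) (hac : a < c) :
    ∃ p d q, π = p ++ d :: q ∧ a ∈ q ∧ c ∈ p ∧ c < d ∧ ∀ b ∈ l₁, b < c → b ∈ p := by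
  induction hn : π.length using Nat.strong_induction_on generalizing π l₁ l₂ with
  | _ n ih =>
    have hne : π ≠ [] := by
      rintro rfl
      simp [stackSort, stackRun] at hs
    obtain ⟨l, x, r, rfl, hl, hr⟩ := exists_eq_append_cons_max hπ hne
    rw [stackSort_append_cons l r x (fun y hy => (hl y hy).le) hr] at hs
    have hπ' := List.nodup_append.mp hπ
    have hlr : l.Nodup ∧ r.Nodup := ⟨hπ'.1, (List.nodup_cons.mp hπ'.2.1).2⟩
    rw [List.append_assoc] at hs
    rcases append_eq_append_cons_cases hs with ⟨u, rfl, hu⟩ | ⟨u, hu, rfl⟩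
    · rcases append_eq_append_cons_cases hu with ⟨v, rfl, hv⟩ | ⟨v, hv, rfl⟩
      -- Here `c` is the maximum `x`, which leaves last, so no `a` can follow it.
      · exfalso
        have := congrArg List.length hv
        simp at this
        have hl2 := List.length_pos_of_mem ha
        omega
      · have hax : a ∈ v := by
          rcases List.mem_append.mp ha with h | h
          · exact h
          · exfalso
            have hc : c < x := hr c ((stackSort_perm r).mem_iff.mp (by rw [hv]; simp))
            simp at h
            omega
        obtain ⟨p, d, q, rfl, h1, h2, h3, h4⟩ := ih r.length (by rw [← hn]; simp; omega)
          hlr.2 hv hax rfl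
        refine ⟨l ++ x :: p, d, q, by simp, h1, by simp [h2], h3, fun b hb hbc => ?_⟩
        rcases List.mem_append.mp hb with hb | hb
        · exact List.mem_append_left _ ((stackSort_perm l).mem_iff.mp hb)
        · simp [h4 b hb hbc]
    · have hcl : c ∈ l := (stackSort_perm l).mem_iff.mp (by rw [hu]; simp)
      rcases List.mem_append.mp ha with ha | ha
      · obtain ⟨p, d, q, rfl, h1, h2, h3, h4⟩ := ih l.length (by rw [← hn]; simp)
          hlr.1 hu ha rfl
        exact ⟨p, d, q ++ x :: r, by simp, by simp [h1], h2, h3, h4⟩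
      -- The output of `l` contains `c` but not `a`, so the maximum itself separates them: `d = x`.
      · refine ⟨l, x, r, rfl, ?_, hcl, hl c hcl, fun b hb _ => ?_⟩
        · rcases List.mem_append.mp ha with ha | ha
          · exact (stackSort_perm r).mem_iff.mp ha
          · have := hl c hcl
            simp at ha
            omega
        · exact (stackSort_perm l).mem_iff.mp (by rw [hu]; simp [hb])

/-- Every inversion `c, a` of `π` has fewer than `t` entries before `c` with value strictly between
`a` and `c`. -/
def FewBetween (t : ℕ) (π : List ℕ) : Prop :=
  ∀ l₁ c l₂ a, π = l₁ ++ c :: l₂ → a ∈ l₂ → a < c →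
    l₁.countP (fun b => a < b ∧ b < c) < t

/-- The inversion `c, a` of the output lifts to an inversion `d, a` of `π`. All entries counted for
the former are counted for the latter, and so is `c` itself; hence the bound drops by one. -/
theorem FewBetween.stackSort {t : ℕ} {π : List ℕ} (hπ : π.Nodup) (h : FewBetween (t + 1) π) :
    FewBetween t (stackSort π) := by
  intro l₁ c l₂ a hs ha hac
  obtain ⟨p, d, q, hpi, haq, hcp, hcd, hb⟩ := exists_between_of_stackSort_inversion hπ hs ha hac
  have h1 := h p d q a hpi haq (by omega)
  have hnd : (l₁ ++ c :: l₂).Nodup := by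
    rw [← hs]
    exact (stackSort_perm π).nodup_iff.mpr hπ
  have hnd' := List.nodup_append.mp hnd
  have hsub : (c :: l₁.filter (fun b => a < b ∧ b < c)).Subperm
      (p.filter (fun b => a < b ∧ b < d)) := by
    refine List.subperm_of_subset ?_ ?_
    · refine List.nodup_cons.mpr ⟨by simp, hnd'.1.filter _⟩
    · intro b hbm
      rcases List.mem_cons.mp hbm with rfl | hbm
      · simp [hcp, hac, hcd]
      · simp only [List.mem_filter, decide_eq_true_eq] at hbm ⊢
        exact ⟨hb b hbm.1 hbm.2.2, hbm.2.1, by omega⟩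
  have := hsub.length_le
  rw [List.length_cons, ← List.countP_eq_length_filter, ← List.countP_eq_length_filter] at this
  omega

theorem FewBetween.isStackSortable {t : ℕ} {π : List ℕ} (hπ : π.Nodup) (h : FewBetween t π) :
    IsStackSortable t π := by
  induction t generalizing π with
  | zero =>
    have hp : π.Pairwise (· ≤ ·) := by
      rw [List.pairwise_iff_forall_sublist]
      intro a b hab
      by_contra hlt
      obtain ⟨r₁, r₂, rfl, ha, hb⟩ := List.cons_sublist_iff.mp hab
      obtain ⟨u, v, rfl⟩ := List.append_of_mem ha
      have := h u a (v ++ r₂) b (by simp) (by simp [List.singleton_sublist.mp hb]) (by omega)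
      omega
    exact (hp.and hπ).imp fun h => lt_of_le_of_ne h.1 h.2
  | succ t ih =>
    exact ih ((stackSort_perm π).nodup_iff.mpr hπ) (h.stackSort hπ)

/-! ### Exponential upper bound -/

/-- The pushes (`true`) and pops (`false`) performed by `stackRun`. -/
def stackWord : List ℕ → List ℕ → List Bool
  | [], [] => []
  | _ :: stack, [] => false :: stackWord stack []
  | [], x :: input => true :: stackWord [x] input
  | y :: stack, x :: input =>
      if x < y then true :: stackWord (x :: y :: stack) input
      else false :: stackWord stack (x :: input)
termination_by stack input => stack.length + 2 * input.length

theorem length_stackWord (st inp : List ℕ) :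
    (stackWord st inp).length = st.length + 2 * inp.length := by
  fun_induction stackWord st inp with
  | case1 => rfl
  | case2 y st ih => simp [ih]
  | case3 x inp ih => simp [ih]; omega
  | case4 y st x inp h ih => simp [ih]; omega
  | case5 y st x inp h ih => simp [ih]; omega

theorem stackWord_eq_cases (st inp : List ℕ) :
    (st = [] ∧ inp = [] ∧ stackWord st inp = []) ∨
    (∃ x inp', inp = x :: inp' ∧ stackWord st inp = true :: stackWord (x :: st) inp' ∧
      stackRun st inp = stackRun (x :: st) inp') ∨
    (∃ y st', st = y :: st' ∧ stackWord st inp = false :: stackWord st' inp ∧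
      stackRun st inp = y :: stackRun st' inp) := by
  rcases st with _ | ⟨y, st⟩ <;> rcases inp with _ | ⟨x, inp⟩
  · simp [stackWord]
  · simp [stackWord, stackRun]
  · simp [stackWord, stackRun]
  · by_cases h : x < y <;> simp [stackWord, stackRun, h]

/-- Each move can be undone: a push from the state it leads to, a pop once the emitted entry is also
known. -/
theorem eq_of_stackWord_eq_of_stackRun_eq {st inp st' inp' : List ℕ}
    (hw : stackWord st inp = stackWord st' inp') (hr : stackRun st inp = stackRun st' inp') :
    st = st' ∧ inp = inp' := by
  induction h : stackWord st inp generalizing st inp st' inp' with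
  | nil =>
    have h1 := length_stackWord st inp
    have h2 := length_stackWord st' inp'
    rw [← hw] at h2
    rw [h, List.length_nil] at h1 h2
    have e1 : st = [] := List.length_eq_zero_iff.mp (by omega)
    have e2 : inp = [] := List.length_eq_zero_iff.mp (by omega)
    have e3 : st' = [] := List.length_eq_zero_iff.mp (by omega)
    have e4 : inp' = [] := List.length_eq_zero_iff.mp (by omega)
    exact ⟨e1.trans e3.symm, e2.trans e4.symm⟩
  | cons b w ih =>
    have h' := hw.symm.trans h
    rcases stackWord_eq_cases st inp with ⟨-, -, h0⟩ | ⟨x, u, rfl, h1, h2⟩ | ⟨x, u, rfl, h1, h2⟩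
    · rw [h0] at h
      cases h
    all_goals
      rcases stackWord_eq_cases st' inp' with
        ⟨-, -, k0⟩ | ⟨y, v, rfl, k1, k2⟩ | ⟨y, v, rfl, k1, k2⟩
      · rw [k0] at h'
        cases h'
      all_goals
        rw [h1, List.cons.injEq] at h
        rw [k1, List.cons.injEq] at h'
        first
        | exact absurd (h.1.trans h'.1.symm) (by decide)
        | skip
    · obtain ⟨e1, rfl⟩ := ih (h.2.trans h'.2.symm) (h2.symm.trans (hr.trans k2)) h.2
      obtain ⟨rfl, rfl⟩ := List.cons.inj e1
      exact ⟨rfl, rfl⟩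
    · obtain ⟨rfl, e⟩ := List.cons.inj (h2.symm.trans (hr.trans k2))
      obtain ⟨rfl, rfl⟩ := ih (h.2.trans h'.2.symm) e h.2
      exact ⟨rfl, rfl⟩

theorem length_of_mem_permsOf {n : ℕ} {π : List ℕ} (h : π ∈ permsOf n) : π.length = n := by
  rw [permsOf, List.mem_toFinset, List.mem_permutations] at h
  simpa using h.length_eq

theorem mem_permsOf_of_perm {n : ℕ} {π σ : List ℕ} (h : π.Perm σ) (hσ : σ ∈ permsOf n) :
    π ∈ permsOf n := by
  rw [permsOf, List.mem_toFinset, List.mem_permutations] at hσ ⊢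
  exact h.trans hσ

theorem stackSortableCount_zero_le (n : ℕ) : stackSortableCount 0 n ≤ 1 := by
  rw [stackSortableCount, Finset.card_le_one]
  intro π hπ σ hσ
  simp only [permsOf, Finset.mem_filter, List.mem_toFinset, List.mem_permutations] at hπ hσ
  exact (hπ.1.trans hσ.1.symm).eq_of_pairwise (fun a b _ _ h1 h2 => absurd h1 (by omega)) hπ.2 hσ.2

theorem stackSortableCount_succ_le (t n : ℕ) :
    stackSortableCount (t + 1) n ≤ 4 ^ n * stackSortableCount t n := by
  classical
  have hcard : (((permsOf n).filter (IsStackSortable t)) ×ˢ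
      (Finset.univ : Finset (Fin (2 * n) → Bool))).card = 4 ^ n * stackSortableCount t n := by
    rw [Finset.card_product, stackSortableCount, mul_comm]
    simp [pow_mul]
  rw [← hcard]
  refine Finset.card_le_card_of_injOn
    (fun π => (stackSort π, fun i => (stackWord [] π).getD i false)) ?_ ?_
  · intro π hπ
    simp only [Finset.coe_filter, Set.mem_ofPred_eq] at hπ
    simp only [Finset.coe_product, Set.mem_prod, Finset.coe_filter, Set.mem_ofPred_eq,
      Finset.coe_univ, Set.mem_univ, and_true]
    exact ⟨mem_permsOf_of_perm (stackSort_perm π) hπ.1, hπ.2⟩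
  · intro π hπ σ hσ h
    simp only [Finset.coe_filter, Set.mem_ofPred_eq] at hπ hσ
    simp only [Prod.mk.injEq] at h
    refine (eq_of_stackWord_eq_of_stackRun_eq ?_ h.1).2
    have l1 : (stackWord [] π).length = 2 * n := by
      simp [length_stackWord, length_of_mem_permsOf hπ.1]
    have l2 : (stackWord [] σ).length = 2 * n := by
      simp [length_stackWord, length_of_mem_permsOf hσ.1]
    refine List.ext_getElem (l1.trans l2.symm) fun i h1 h2 => ?_
    have := congrFun h.2 ⟨i, by omega⟩
    simpa [h1, h2] using this

theorem stackSortableCount_le (t n : ℕ) : stackSortableCount t n ≤ (4 ^ t) ^ n := by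
  induction t with
  | zero => simpa using stackSortableCount_zero_le n
  | succ t ih =>
    calc _ ≤ 4 ^ n * stackSortableCount t n := stackSortableCount_succ_le t n
      _ ≤ 4 ^ n * (4 ^ t) ^ n := Nat.mul_le_mul_left _ ih
      _ = _ := by rw [pow_succ (4 : ℕ) t, mul_pow, mul_comm]

/-! ### Supermultiplicativity and existence of the limit -/

theorem range'_mem_permsOf (n : ℕ) : List.range' 1 n ∈ permsOf n := by
  rw [permsOf, List.mem_toFinset, List.mem_permutations]

theorem fewBetween_range' {t : ℕ} (n : ℕ) : FewBetween t (List.range' 1 n) := by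
  intro l₁ c l₂ a h ha hac
  have hp : (List.range' 1 n).Pairwise (· < ·) := List.pairwise_lt_range'
  rw [h, List.pairwise_append, List.pairwise_cons] at hp
  have := hp.2.1.1 a ha
  omega

theorem stackSortableCount_pos (t n : ℕ) : 0 < stackSortableCount t n :=
  Finset.card_pos.mpr ⟨List.range' 1 n, Finset.mem_filter.mpr ⟨range'_mem_permsOf n,
    (fewBetween_range' n).isStackSortable List.nodup_range'⟩⟩

theorem stackSortableCount_mul_le (t m n : ℕ) :
    stackSortableCount t m * stackSortableCount t n ≤ stackSortableCount t (m + n) := by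
  rw [stackSortableCount, stackSortableCount, ← Finset.card_product]
  have hf : StrictMono (fun x : ℕ => x + m) := fun _ _ h => Nat.add_lt_add_right h m
  refine Finset.card_le_card_of_injOn (fun p => p.1 ++ p.2.map (fun x => x + m)) ?_ ?_
  · rintro ⟨π, σ⟩ h
    simp only [Finset.coe_product, Finset.coe_filter, Set.mem_prod, Set.mem_ofPred_eq] at h
    obtain ⟨⟨hπ, hπt⟩, hσ, hσt⟩ := h
    have hπ' := mem_permsOf.mp hπ
    have hσ' := mem_permsOf.mp hσ
    have hlt : ∀ y ∈ π, ∀ x ∈ σ.map (fun x => x + m), y < x := by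
      intro y hy x hx
      obtain ⟨z, hz, rfl⟩ := List.mem_map.mp hx
      have h1 := (hπ'.2 y).mp hy
      have h2 := (hσ'.2 z).mp hz
      show y < z + m
      omega
    simp only [Finset.coe_filter, Set.mem_ofPred_eq]
    refine ⟨mem_permsOf.mpr ⟨?_, fun k => ?_⟩, ?_⟩
    · exact List.nodup_append.mpr ⟨hπ'.1, hσ'.1.map hf.injective,
        fun y hy x hx => (hlt y hy x hx).ne⟩
    · rw [List.mem_append, List.mem_map, hπ'.2]
      constructor
      · rintro (h | ⟨z, hz, rfl⟩)
        · omega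
        · have := (hσ'.2 z).mp hz
          omega
      · intro h
        by_cases hk : k ≤ m
        · exact Or.inl ⟨h.1, hk⟩
        · exact Or.inr ⟨k - m, (hσ'.2 _).mpr (by omega), by omega⟩
    · rw [IsStackSortable, stackSort_iterate_append _ _ _ fun y hy x hx => (hlt y hy x hx).le,
        stackSort_iterate_map hf, List.pairwise_append]
      refine ⟨hπt, List.Pairwise.map _ (fun _ _ h => hf h) hσt, fun y hy x hx => ?_⟩
      exact hlt y ((stackSort_iterate_perm t π).mem_iff.mp hy) x
        (((stackSort_iterate_perm t σ).map _).mem_iff.mp hx)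
  · rintro ⟨π, σ⟩ h ⟨π', σ'⟩ h' heq
    simp only [Finset.coe_product, Finset.coe_filter, Set.mem_prod, Set.mem_ofPred_eq] at h h'
    obtain ⟨e1, e2⟩ := List.append_inj heq
      ((length_of_mem_permsOf h.1.1).trans (length_of_mem_permsOf h'.1.1).symm)
    exact Prod.ext e1 (List.map_injective_iff.mpr hf.injective e2)

theorem tendsto_rpow_of_supermultiplicative {u : ℕ → ℝ} (hpos : ∀ n, 0 < u n)
    (hmul : ∀ m n, u m * u n ≤ u (m + n)) {C : ℝ} (hle : ∀ n, u n ≤ C ^ n) :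
    ∃ L : ℝ, Filter.Tendsto (fun n : ℕ => u n ^ (1 / (n : ℝ))) Filter.atTop (nhds L) := by
  have hsub : Subadditive fun n => -Real.log (u n) := by
    intro m n
    have := Real.log_le_log (mul_pos (hpos m) (hpos n)) (hmul m n)
    rw [Real.log_mul (hpos m).ne' (hpos n).ne'] at this
    linarith
  have hbdd : BddBelow (Set.range fun n : ℕ => -Real.log (u n) / n) := by
    -- The absolute value covers `n = 0`, where the quotient is `0` by convention.
    refine ⟨-|Real.log C|, ?_⟩
    rintro _ ⟨n, rfl⟩
    show -|Real.log C| ≤ -Real.log (u n) / n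
    rcases Nat.eq_zero_or_pos n with rfl | hn
    · simp
    · have h1 := Real.log_le_log (hpos n) (hle n)
      rw [Real.log_pow] at h1
      have hn' : (0 : ℝ) < n := by exact_mod_cast hn
      rw [le_div_iff₀ hn']
      nlinarith [le_abs_self (Real.log C)]
  refine ⟨Real.exp (-hsub.lim), ?_⟩
  have := (hsub.tendsto_lim hbdd).neg
  refine ((Real.continuous_exp.tendsto _).comp this).congr fun n => ?_
  rw [Function.comp_apply, Real.rpow_def_of_pos (hpos n)]
  congr 1
  ring

theorem exists_tendsto_stackSortableCount_rpow (t : ℕ) :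
    ∃ L : ℝ, Filter.Tendsto (fun n : ℕ => (stackSortableCount t n : ℝ) ^ (1 / (n : ℝ)))
      Filter.atTop (nhds L) :=
  tendsto_rpow_of_supermultiplicative (C := 4 ^ t)
    (fun n => by exact_mod_cast stackSortableCount_pos t n)
    (fun m n => by exact_mod_cast stackSortableCount_mul_le t m n)
    (fun n => by exact_mod_cast stackSortableCount_le t n)

/-! ### Appending a last entry -/

/-- Make room for a new value `a`. -/
def bump (a x : ℕ) : ℕ := if a ≤ x then x + 1 else x

theorem bump_strictMono (a : ℕ) : StrictMono (bump a) := by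
  intro x y h
  simp only [bump]
  split_ifs <;> omega

theorem lt_bump_iff {a x : ℕ} : a < bump a x ↔ a ≤ x := by
  simp only [bump]
  split_ifs <;> omega

/-- Append a new last entry `a`, after increasing the entries that are at least `a`. -/
def appendValue (π : List ℕ) (a : ℕ) : List ℕ := π.map (bump a) ++ [a]

theorem appendValue_injective {π σ : List ℕ} {a b : ℕ} (h : appendValue π a = appendValue σ b) :
    π = σ ∧ a = b := by
  obtain ⟨h1, h2⟩ := List.append_inj' h rfl
  obtain rfl : a = b := by simpa using h2
  exact ⟨List.map_injective_iff.mpr (bump_strictMono a).injective h1, rfl⟩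

theorem appendValue_mem_permsOf {n a : ℕ} {π : List ℕ} (hπ : π ∈ permsOf n) (h1 : 1 ≤ a)
    (ha : a ≤ n + 1) : appendValue π a ∈ permsOf (n + 1) := by
  obtain ⟨hnd, hmem⟩ := mem_permsOf.mp hπ
  refine mem_permsOf.mpr ⟨?_, fun k => ?_⟩
  · refine List.nodup_append.mpr ⟨hnd.map (bump_strictMono a).injective, by simp, ?_⟩
    intro x hx y hy
    obtain ⟨z, -, rfl⟩ := List.mem_map.mp hx
    obtain rfl : y = a := by simpa using hy
    simp only [bump]
    split_ifs <;> omega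
  · rw [appendValue, List.mem_append, List.mem_map, List.mem_singleton]
    constructor
    · rintro (⟨z, hz, rfl⟩ | rfl)
      · have := (hmem z).mp hz
        simp only [bump]
        split_ifs <;> omega
      · omega
    · intro hk
      rcases lt_trichotomy k a with h | h | h
      · exact Or.inl ⟨k, (hmem k).mpr (by omega), by simp only [bump]; split_ifs <;> omega⟩
      · exact Or.inr h
      · exact Or.inl ⟨k - 1, (hmem _).mpr (by omega), by simp only [bump]; split_ifs <;> omega⟩

/-- Decomposing `appendValue π a` at an entry: either the new one, or one of `π`. -/
theorem appendValue_eq_append_cons {π l₁ l₂ : List ℕ} {a c : ℕ}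
    (h : appendValue π a = l₁ ++ c :: l₂) :
    (l₁ = π.map (bump a) ∧ c = a ∧ l₂ = []) ∨
    ∃ p d q, π = p ++ d :: q ∧ l₁ = p.map (bump a) ∧ c = bump a d ∧
      l₂ = q.map (bump a) ++ [a] := by
  rcases append_eq_append_cons_cases h with ⟨u, rfl, hu⟩ | ⟨u, hu, rfl⟩
  · left
    rcases u with _ | ⟨w, u⟩
    · simp only [List.nil_append, List.cons.injEq] at hu
      exact ⟨by simp, hu.1.symm, hu.2.symm⟩
    · simp at hu
  · right
    obtain ⟨p, q', rfl, rfl, hq⟩ := List.map_eq_append_iff.mp hu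
    obtain ⟨d, q, rfl, rfl, rfl⟩ := List.map_eq_cons_iff.mp hq
    exact ⟨p, d, q, rfl, rfl, rfl, rfl⟩

/-- Appending the value `a` to `π` creates no inversion with `t` entries in between. -/
def Appendable (t a : ℕ) (π : List ℕ) : Prop :=
  ∀ l₁ c l₂, π = l₁ ++ c :: l₂ → a ≤ c → l₁.countP (fun b => a ≤ b ∧ b < c) < t

/-- Old inversions keep their counts, since `bump a` preserves order and the new entry precedes
nothing; inversions ending in the new entry are controlled by `Appendable`. -/
theorem FewBetween.appendValue {t a : ℕ} {π : List ℕ} (h : FewBetween t π)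
    (ha : Appendable t a π) : FewBetween t (appendValue π a) := by
  intro l₁ c l₂ x hs hx hxc
  rcases appendValue_eq_append_cons hs with ⟨-, -, rfl⟩ | ⟨p, d, q, rfl, rfl, rfl, rfl⟩
  · simp at hx
  · rw [List.countP_map]
    rcases List.mem_append.mp hx with hx | hx
    · obtain ⟨y, hy, rfl⟩ := List.mem_map.mp hx
      refine lt_of_eq_of_lt (List.countP_congr fun b _ => ?_)
        (h p d q y rfl hy ((bump_strictMono a).lt_iff_lt.mp hxc))
      simp [(bump_strictMono a).lt_iff_lt]
    · obtain rfl : x = a := by simpa using hx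
      refine lt_of_eq_of_lt (List.countP_congr fun b _ => ?_) (ha p d q rfl (lt_bump_iff.mp hxc))
      simp [(bump_strictMono x).lt_iff_lt, lt_bump_iff]

theorem List.Nodup.countP_Ico_le {l : List ℕ} (hl : l.Nodup) (a b : ℕ) :
    l.countP (fun x => a ≤ x ∧ x < b) ≤ b - a := by
  rw [List.countP_eq_length_filter, ← List.toFinset_card_of_nodup (hl.filter _), ← Nat.card_Ico]
  refine Finset.card_le_card fun x hx => ?_
  simpa using (List.mem_filter.mp (List.mem_toFinset.mp hx)).2

/-- The only new constraint has the appended `a` as the larger entry, and at most `a - a' < t`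
distinct values lie in `[a', a)`. -/
theorem appendable_appendValue_of_le {t a a' : ℕ} {π : List ℕ} (hπ : π.Nodup)
    (h : Appendable t a' π) (ha : a' ≤ a) (hat : a < a' + t) :
    Appendable t a' (appendValue π a) := by
  intro l₁ c l₂ hs hc
  rcases appendValue_eq_append_cons hs with ⟨rfl, rfl, -⟩ | ⟨p, d, q, rfl, rfl, rfl, -⟩
  · have := (hπ.map (bump_strictMono c).injective).countP_Ico_le a' c
    omega
  · have key : ∀ b, a' ≤ bump a b ↔ a' ≤ b := by
      intro b
      simp only [bump]
      split_ifs <;> omega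
    rw [List.countP_map]
    refine lt_of_eq_of_lt (List.countP_congr fun b _ => ?_) (h p d q rfl ((key d).mp hc))
    simp [(bump_strictMono a).lt_iff_lt, key]

theorem appendable_appendValue_of_lt {t a a' : ℕ} {π : List ℕ}
    (h : Appendable t a' π) (ha : a ≤ a') : Appendable t (a' + 1) (appendValue π a) := by
  intro l₁ c l₂ hs hc
  rcases appendValue_eq_append_cons hs with ⟨rfl, rfl, -⟩ | ⟨p, d, q, rfl, rfl, rfl, -⟩
  · omega
  · have key : ∀ b, a' < bump a b ↔ a' ≤ b := by
      intro b
      simp only [bump]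
      split_ifs <;> omega
    rw [List.countP_map]
    refine lt_of_eq_of_lt (List.countP_congr fun b _ => ?_) (h p d q rfl ((key d).mp hc))
    simp [(bump_strictMono a).lt_iff_lt, key]

/-! ### The generating tree -/

/-- A generating tree of permutations of `{1, …, t + i}` with `FewBetween t`. A node `(π, m)`
records that the `m + t` largest values can be appended to `π`. -/
def fewBetweenTree (t : ℕ) : ℕ → Finset (List ℕ × ℕ)
  | 0 => {(List.range' 1 t, 1)}
  | i + 1 => (fewBetweenTree t i).biUnion fun p =>
      (Finset.Icc 1 (p.2 + t)).image fun j => (appendValue p.1 (t + i + 2 - j), min j (p.2 + 1))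

theorem fewBetweenTree_spec {t i : ℕ} {p : List ℕ × ℕ} (hp : p ∈ fewBetweenTree t i) :
    p.1 ∈ permsOf (t + i) ∧ FewBetween t p.1 ∧ 1 ≤ p.2 ∧ p.2 ≤ i + 1 ∧
      ∀ a ≤ t + i + 1, t + i + 1 < a + (p.2 + t) → Appendable t a p.1 := by
  induction i generalizing p with
  | zero =>
    obtain rfl : p = (List.range' 1 t, 1) := by simpa [fewBetweenTree] using hp
    refine ⟨range'_mem_permsOf t, fewBetween_range' t, le_rfl, le_rfl, fun a _ _ => ?_⟩
    intro l₁ c l₂ h _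
    have hlen := congrArg List.length h
    simp only [List.length_range', List.length_append, List.length_cons] at hlen
    have := List.countP_le_length (p := fun b => decide (a ≤ b ∧ b < c)) (l := l₁)
    omega
  | succ i ih =>
    simp only [fewBetweenTree, Finset.mem_biUnion, Finset.mem_image, Finset.mem_Icc] at hp
    obtain ⟨q, hq, j, hj, rfl⟩ := hp
    obtain ⟨h1, h2, h3, h4, h5⟩ := ih hq
    have ha1 : t + i + 2 - j ≤ t + i + 1 := by omega
    refine ⟨appendValue_mem_permsOf h1 (by omega) ha1,
      h2.appendValue (h5 _ (by omega) (by omega)), by simp; omega, by simp; omega, ?_⟩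
    intro a ha hat
    simp only at hat ⊢
    -- All `j` values above the new entry stay admissible, as do those less than `t` below or equal
    -- to it that were admissible before; this gives the label `min j (m + 1)`.
    by_cases hle : a ≤ t + i + 2 - j
    · exact appendable_appendValue_of_le (mem_permsOf.mp h1).1 (h5 a (by omega) (by omega)) hle
        (by omega)
    · obtain ⟨a, rfl⟩ : ∃ b, a = b + 1 := ⟨a - 1, by omega⟩
      exact appendable_appendValue_of_lt (h5 a (by omega) (by omega)) (by omega)

theorem fewBetweenTree_fst_injOn (t i : ℕ) :
    Set.InjOn Prod.fst (fewBetweenTree t i : Set (List ℕ × ℕ)) := by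
  induction i with
  | zero => simp [fewBetweenTree]
  | succ i ih =>
    intro p hp p' hp' h
    simp only [fewBetweenTree, Finset.mem_coe, Finset.mem_biUnion, Finset.mem_image,
      Finset.mem_Icc] at hp hp'
    obtain ⟨q, hq, j, hj, rfl⟩ := hp
    obtain ⟨q', hq', j', hj', rfl⟩ := hp'
    obtain ⟨e1, e2⟩ := appendValue_injective h
    obtain rfl := ih hq hq' e1
    -- The label bound `m ≤ i + 1` keeps the subtraction `t + i + 2 - j` from truncating, so it
    -- determines `j`.
    have := fewBetweenTree_spec hq
    obtain rfl : j = j' := by omega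
    rfl

theorem sum_fewBetweenTree_succ (t i : ℕ) (f : ℕ → ℝ) :
    ∑ p ∈ fewBetweenTree t (i + 1), f p.2 =
      ∑ p ∈ fewBetweenTree t i, (∑ j ∈ Finset.Icc 1 p.2, f j + t * f (p.2 + 1)) := by
  rw [fewBetweenTree, Finset.sum_biUnion]
  · refine Finset.sum_congr rfl fun p hp => ?_
    have hsp := fewBetweenTree_spec hp
    rw [Finset.sum_image]
    · have hIcc : Finset.Icc 1 (p.2 + t) = Finset.Icc 1 p.2 ∪ Finset.Icc (p.2 + 1) (p.2 + t) := by
        ext x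
        simp only [Finset.mem_Icc, Finset.mem_union]
        omega
      rw [hIcc, Finset.sum_union]
      · congr 1
        · refine Finset.sum_congr rfl fun j hj => ?_
          rw [Finset.mem_Icc] at hj
          rw [min_eq_left (by omega)]
        · rw [Finset.sum_congr rfl (g := fun _ => f (p.2 + 1))]
          · simp
          · intro j hj
            rw [Finset.mem_Icc] at hj
            rw [min_eq_right (by omega)]
      · rw [Finset.disjoint_left]
        intro x hx hx'
        rw [Finset.mem_Icc] at hx hx'
        omega
    · intro j hj j' hj' h
      rw [Finset.mem_coe, Finset.mem_Icc] at hj hj'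
      have := (appendValue_injective (Prod.ext_iff.mp h).1).2
      omega
  · intro p hp q hq hpq
    rw [Function.onFun, Finset.disjoint_left]
    rintro x hx hx'
    obtain ⟨j, -, rfl⟩ := Finset.mem_image.mp hx
    obtain ⟨j', -, h⟩ := Finset.mem_image.mp hx'
    exact hpq (fewBetweenTree_fst_injOn t i hp hq
      (appendValue_injective (Prod.ext_iff.mp h).1).1.symm)

theorem card_fewBetweenTree_le (t i : ℕ) :
    (fewBetweenTree t i).card ≤ stackSortableCount t (t + i) := by
  refine Finset.card_le_card_of_injOn Prod.fst (fun p hp => ?_) (fewBetweenTree_fst_injOn t i)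
  obtain ⟨h1, h2, -⟩ := fewBetweenTree_spec hp
  exact Finset.mem_coe.mpr (Finset.mem_filter.mpr
    ⟨h1, h2.isStackSortable (mem_permsOf.mp h1).1⟩)

/-! ### Weights on the labels -/

/-- A subinvariant weight on the labels of the generating tree gives a lower bound. -/
theorem mul_pow_le_stackSortableCount {t : ℕ} {f : ℕ → ℝ} {lam B : ℝ} (hlam : 0 ≤ lam)
    (hB : 0 < B) (hfB : ∀ m, f m ≤ B)
    (hf : ∀ m, lam * f m ≤ ∑ j ∈ Finset.Icc 1 m, f j + t * f (m + 1)) (i : ℕ) :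
    f 1 / B * lam ^ i ≤ stackSortableCount t (t + i) := by
  have h1 : ∀ i, f 1 * lam ^ i ≤ ∑ p ∈ fewBetweenTree t i, f p.2 := by
    intro i
    induction i with
    | zero => simp [fewBetweenTree]
    | succ i ih =>
      rw [sum_fewBetweenTree_succ]
      calc f 1 * lam ^ (i + 1) = lam * (f 1 * lam ^ i) := by ring
        _ ≤ lam * ∑ p ∈ fewBetweenTree t i, f p.2 := mul_le_mul_of_nonneg_left ih hlam
        _ = ∑ p ∈ fewBetweenTree t i, lam * f p.2 := Finset.mul_sum _ _ _
        _ ≤ _ := Finset.sum_le_sum fun p _ => hf p.2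
  have h2 : ∑ p ∈ fewBetweenTree t i, f p.2 ≤ (fewBetweenTree t i).card * B := by
    simpa using Finset.sum_le_card_nsmul (fewBetweenTree t i) (fun p => f p.2) B
      fun p _ => hfB p.2
  have h3 : ((fewBetweenTree t i).card : ℝ) ≤ stackSortableCount t (t + i) := by
    exact_mod_cast card_fewBetweenTree_le t i
  rw [div_mul_eq_mul_div, div_le_iff₀ hB]
  exact (h1 i).trans (h2.trans (mul_le_mul_of_nonneg_right h3 hB.le))

/-- The solution of `t g(m+2) = (lam + t - 1) g(m+1) - lam g(m)`, `g(0) = 0`, `g(1) = 1`. -/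
noncomputable def labelWeight (t lam : ℝ) : ℕ → ℝ
  | 0 => 0
  | 1 => 1
  | m + 2 => ((lam + t - 1) * labelWeight t lam (m + 1) - lam * labelWeight t lam m) / t

/-- The recurrence is the difference of this identity at consecutive `m`; the surplus `t > 0` makes
the weight subinvariant. -/
theorem sum_labelWeight {t : ℝ} (ht : 0 < t) (lam : ℝ) (m : ℕ) :
    ∑ j ∈ Finset.Icc 1 m, labelWeight t lam j + t * labelWeight t lam (m + 1) =
      lam * labelWeight t lam m + t := by
  induction m with
  | zero => simp [labelWeight]
  | succ m ih =>
    rw [Finset.sum_Icc_succ_top (by omega), labelWeight]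
    field_simp
    linarith

/-- For negative discriminant the solution of the recurrence does not stay positive. -/
theorem exists_labelWeight_nonpos {t lam : ℝ} (ht : 0 < t)
    (hdisc : (lam + t - 1) ^ 2 < 4 * t * lam) : ∃ m, labelWeight t lam (m + 1) ≤ 0 := by
  by_contra! hpos
  set g := labelWeight t lam with hg
  let r : ℕ → ℝ := fun k => g (k + 2) / g (k + 1)
  have hr : ∀ k, 0 < r k := fun k => div_pos (hpos (k + 1)) (hpos k)
  have hrec : ∀ k, t * r (k + 1) * r k = (lam + t - 1) * r k - lam := by
    intro k
    have h1 := (hpos k).ne'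
    have h2 := (hpos (k + 1)).ne'
    have h3 : t * g (k + 3) = (lam + t - 1) * g (k + 2) - lam * g (k + 1) := by
      rw [hg, labelWeight]
      field_simp
    simp only [r]
    field_simp
    linarith
  set δ := (4 * t * lam - (lam + t - 1) ^ 2) / (4 * t) with hδ
  have hδ0 : 0 < δ := div_pos (by linarith) (by linarith)
  -- By `hrec` the right side is the quadratic `t r² - (lam + t - 1) r + lam` at `r k`, and `δ` is
  -- its minimum. The positive ratios thus decrease by a fixed amount at each step, which is absurd.
  have hstep : ∀ k, δ ≤ t * (r k - r (k + 1)) * r k := by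
    intro k
    have h := hrec k
    rw [hδ, div_le_iff₀ (by linarith)]
    nlinarith [sq_nonneg (2 * t * r k - (lam + t - 1))]
  have hdec : ∀ k, r (k + 1) ≤ r k := by
    intro k
    by_contra! hlt
    have : t * (r k - r (k + 1)) * r k ≤ 0 :=
      mul_nonpos_of_nonpos_of_nonneg (mul_nonpos_of_nonneg_of_nonpos ht.le (by linarith)) (hr k).le
    linarith [hstep k]
  have hanti : Antitone r := antitone_nat_of_succ_le hdec
  set ε := δ / (t * r 0) with hε
  have hε0 : 0 < ε := div_pos hδ0 (mul_pos ht (hr 0))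
  have hstep' : ∀ k, r (k + 1) ≤ r k - ε := by
    intro k
    have h0 : t * (r k - r (k + 1)) * r k ≤ t * (r k - r (k + 1)) * r 0 :=
      mul_le_mul_of_nonneg_left (hanti (Nat.zero_le k))
        (mul_nonneg ht.le (by linarith [hdec k]))
    have : ε ≤ r k - r (k + 1) := by
      rw [hε, div_le_iff₀ (mul_pos ht (hr 0))]
      linarith [hstep k]
    linarith
  have hlin : ∀ k : ℕ, r k ≤ r 0 - k * ε := by
    intro k
    induction k with
    | zero => simp
    | succ k ih =>
      push_cast
      linarith [hstep' k]
  obtain ⟨k, hk⟩ := exists_nat_gt (r 0 / ε)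
  rw [div_lt_iff₀ hε0] at hk
  linarith [hlin k, hr k]

theorem exists_subinvariant_weight {t lam : ℝ} (ht : 0 < t)
    (hdisc : (lam + t - 1) ^ 2 < 4 * t * lam) :
    ∃ (f : ℕ → ℝ) (B : ℝ), 0 < B ∧ f 1 = 1 ∧ (∀ m, f m ≤ B) ∧
      ∀ m, lam * f m ≤ ∑ j ∈ Finset.Icc 1 m, f j + t * f (m + 1) := by
  classical
  have hex := exists_labelWeight_nonpos ht hdisc
  set g := labelWeight t lam with hg
  set K := Nat.find hex with hK
  have hKspec : g (K + 1) ≤ 0 := Nat.find_spec hex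
  have hKmin : ∀ m < K, 0 < g (m + 1) := fun m hm => not_le.mp (Nat.find_min hex hm)
  have hg1 : g 1 = 1 := by rw [hg, labelWeight]
  have hK1 : 1 ≤ K := by
    by_contra! h
    have : K = 0 := by omega
    rw [this, zero_add, hg1] at hKspec
    linarith
  -- Replacing `g (K + 1) ≤ 0` by `0` only helps the inequality at `m = K`, and finite support makes
  -- `f` bounded.
  let f : ℕ → ℝ := fun m => if m ≤ K then g m else 0
  have hf0 : ∀ m, 0 ≤ f m := by
    intro m
    simp only [f]
    split_ifs with h
    · rcases m with _ | m
      · rw [hg, labelWeight]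
      · exact (hKmin m (by omega)).le
    · exact le_rfl
  have hf1 : f 1 = 1 := by simp only [f, if_pos hK1, hg1]
  have hfB : ∀ m, f m ≤ ∑ i ∈ Finset.range (K + 1), f i := by
    intro m
    by_cases h : m ≤ K
    · exact Finset.single_le_sum (fun i _ => hf0 i) (Finset.mem_range.mpr (by omega))
    · have : f m = 0 := if_neg h
      rw [this]
      exact Finset.sum_nonneg fun i _ => hf0 i
  refine ⟨f, _, lt_of_lt_of_le one_pos (hf1 ▸ hfB 1), hf1, hfB, fun m => ?_⟩
  by_cases h : m ≤ K
  · have hsum : ∑ j ∈ Finset.Icc 1 m, f j = ∑ j ∈ Finset.Icc 1 m, g j :=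
      Finset.sum_congr rfl fun j hj => if_pos ((Finset.mem_Icc.mp hj).2.trans h)
    have hnext : g (m + 1) ≤ f (m + 1) := by
      by_cases h' : m + 1 ≤ K
      · exact (if_pos h').ge
      · obtain rfl : m = K := by omega
        exact hKspec.trans (hf0 _)
    have hfm : f m = g m := if_pos h
    have := sum_labelWeight ht lam m
    rw [hsum, hfm]
    nlinarith [mul_le_mul_of_nonneg_left hnext ht.le]
  · have : f m = 0 := if_neg h
    rw [this, mul_zero]
    exact add_nonneg (Finset.sum_nonneg fun i _ => hf0 i) (mul_nonneg ht.le (hf0 _))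

/-! ### Growth rate -/

theorem exists_mul_pow_le_stackSortableCount {t : ℕ} (ht : 1 ≤ t) {μ : ℝ}
    (h1 : Real.sqrt t ≤ μ) (h2 : μ < Real.sqrt t + 1) :
    ∃ c : ℝ, 0 < c ∧ ∀ n, t ≤ n → c * (μ ^ 2) ^ n ≤ stackSortableCount t n := by
  have ht0 : (0 : ℝ) < t := by exact_mod_cast ht
  have hs0 := Real.sqrt_pos.mpr ht0
  have hss := Real.sq_sqrt ht0.le
  set s := Real.sqrt (t : ℝ)
  have hμ0 : 0 < μ := hs0.trans_le h1
  have hdisc : (μ ^ 2 + t - 1) ^ 2 < 4 * t * μ ^ 2 := by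
    rw [← hss]
    have hd : (μ - s) ^ 2 < 1 := by nlinarith
    have hd' : 1 < (μ + s) ^ 2 := by
      have hs1 : 1 ≤ s := Real.one_le_sqrt.mpr (by exact_mod_cast ht)
      nlinarith
    -- Factorization: `4s²μ² - (μ² + s² - 1)² = (1 - (μ - s)²)((μ + s)² - 1)`.
    nlinarith [mul_pos (sub_pos.mpr hd) (sub_pos.mpr hd')]
  obtain ⟨f, B, hB, hf1, hfB, hf⟩ := exists_subinvariant_weight ht0 hdisc
  -- Level `i` of the tree holds permutations of length `t + i`, whence the factor `(μ ^ 2) ^ t`.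
  refine ⟨1 / B / (μ ^ 2) ^ t, by positivity, fun n hn => ?_⟩
  have := mul_pow_le_stackSortableCount (pow_pos hμ0 2).le hB hfB hf (n - t)
  rw [Nat.add_sub_cancel' hn, hf1] at this
  refine le_of_eq_of_le ?_ this
  rw [← Nat.add_sub_cancel' hn, pow_add, Nat.add_sub_cancel_left]
  field_simp

theorem le_of_tendsto_rpow_of_mul_pow_le {u : ℕ → ℝ} {L c r : ℝ} (hc : 0 < c) (hr : 0 ≤ r)
    (hu : Filter.Tendsto (fun n : ℕ => u n ^ (1 / (n : ℝ))) Filter.atTop (nhds L))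
    (h : ∀ᶠ n : ℕ in Filter.atTop, c * r ^ n ≤ u n) : r ≤ L := by
  have hlim : Filter.Tendsto (fun n : ℕ => c ^ (1 / (n : ℝ)) * r) Filter.atTop (nhds r) := by
    have := (Real.continuousAt_const_rpow (a := c) (b := 0) hc.ne').tendsto.comp
      tendsto_one_div_atTop_nhds_zero_nat
    simpa using this.mul_const r
  refine le_of_tendsto_of_tendsto hlim hu ?_
  filter_upwards [h, Filter.eventually_ge_atTop 1] with n hn hn1
  have hn0 : (n : ℝ) ≠ 0 := by exact_mod_cast (by omega : n ≠ 0)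
  calc c ^ (1 / (n : ℝ)) * r = (c * r ^ n) ^ (1 / (n : ℝ)) := by
        rw [Real.mul_rpow hc.le (pow_nonneg hr n), one_div, Real.pow_rpow_inv_natCast hr (by omega)]
    _ ≤ u n ^ (1 / (n : ℝ)) := Real.rpow_le_rpow (by positivity) hn (by positivity)

theorem theorem4 (t : ℕ) (ht : 1 ≤ t) :
    ∃ L : ℝ,
      Filter.Tendsto (fun n : ℕ => (stackSortableCount t n : ℝ) ^ (1 / (n : ℝ)))
        Filter.atTop (nhds L) ∧
      (Real.sqrt (t : ℝ) + 1) ^ 2 ≤ L := by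
  obtain ⟨L, hL⟩ := exists_tendsto_stackSortableCount_rpow t
  refine ⟨L, hL, ?_⟩
  by_contra! hlt
  have hs := Real.sqrt_nonneg (t : ℝ)
  have hLs : Real.sqrt L < Real.sqrt t + 1 := (Real.sqrt_lt' (by linarith)).mpr hlt
  obtain ⟨μ, hμ, hμ'⟩ := exists_between (max_lt hLs (lt_add_one (Real.sqrt (t : ℝ))))
  obtain ⟨hμ1, hμ2⟩ := max_lt_iff.mp hμ
  obtain ⟨c, hc, hcount⟩ := exists_mul_pow_le_stackSortableCount ht hμ2.le hμ'
  have := le_of_tendsto_rpow_of_mul_pow_le hc (sq_nonneg μ) hL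
    (Filter.eventually_atTop.mpr ⟨t, hcount⟩)
  have := (Real.sqrt_lt' (hs.trans_lt hμ2)).mp hμ1
  linarith
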